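/- Conventions. All alphabets are finite. A family of languages $\mathscr{F}$ assigns to every finite alphabet $X$ a set of languages $L \subseteq X^*$. A rational transduction from $X$ to $Y$ is a relation $\rho \subseteq X^* \times Y^*$ accepted by a finite transducer, that is, by a finite directed graph with edges labelled by elements of $X^* \times Y^*$, one initial vertex and a set of terminal vertices; the image of $L \subseteq X^*$ under $\rho$ is $L\rho = \{v \mid (u,v)\in\rho \text{ for some } u \in L\}$. The family $\mathscr{F}$ is closed under rational transduction if it contains $L\rho$ whenever it contains $L$ and $\rho$ is a rational transduction, and closed under Kleene closure if it contains the submonoid $L^*$ of $X^*$ generated by $L$ whenever it contains $L\subseteq X^*$. Let $\sigma : X^* \to M$ be a surjective morphism onto a monoid $M$ (a choice of monoid generators). The loop problem $L_\sigma(M)$ is the language over $X \cup \overline{X}$, where $\overline{X}$ is a disjoint set of formal inverses $\overline{x}$ of the letters $x \in X$, of all labels of paths from $1$ to $1$ in the (possibly infinite) directed graph with vertex set $M$ that has, whenever $a(x\sigma) = b$ with $a, b \in M$ and $x \in X$, an edge from $a$ to $b$ labelled $x$ and an edge from $b$ to $a$ labelled $\overline{x}$. If $\sigma : X^+ \to S$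 is a surjective morphism onto a semigroup $S$ (a choice of semigroup generators), the loop problem $L_\sigma(S)$ is $L_{\sigma^1}(S^1)$, where $S^1$ is $S$ with a new identity adjoined (even if $S$ has an identity) and $\sigma^1 : X^* \to S^1$ extends $\sigma$. If $\sigma : X^* \to G$ is a choice of monoid generators for a group $G$, the word problem of $G$ with respect to $\sigma$ is $\{w \in X^* \mid w\sigma = 1\}$. A choice of generators is finite if $X$ is finite, and a semigroup is finitely generated if it admits a finite choice of semigroup generators. A semigroup is completely simple if it has no proper ideals and has a primitive idempotent, that is, an idempotent $e$ such that $e=f$ for every non-zero idempotent $f$ with $ef=fe=f$. A maximal subgroup of a semigroup is a subsemigroup which is a group under the inherited multiplication and is not properly contained in another such subsemigroup. Theorem. Let $\mathscr{F}$ be a family of languages closed under rational transduction and Kleene closure, and let $S$ be a finitely generated completely simple semigroup. Then every maximal subgroup of $S$ is finitely generated, and the following are equivalent: (i) the loop problem of $S$ belongs to $\mathscr{F}$; (ii) the loop problem of each maximal subgroup of $S$ belongs to $\mathscr{F}$; (iii) the word problem of each maximal subgroup of $S$ belongs to $\mathscr{F}$. Here the loop problem of $S$ is taken with respect to a finite choice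 of semigroup generators, the loop problem of a maximal subgroup with respect to a finite choice of generators either as a semigroup or as a monoid, and its word problem with respect to a finite choice of monoid generators. Each of (i), (ii) (in the semigroup and in the monoid version) and (iii) may be read with "some finite choice of generators" or with "every finite choice of generators" (for each maximal subgroup separately), and all of these readings are equivalent to each other. -/

import Mathlib

universe u v w

open scoped Computability

/-! ### Families of languages, rational transductions -/

/-- A family of languages over finite alphabets: for every finite alphabet `X`, a set of
languages over `X`. -/
abbrev LanguageFamily : Type (u + 1) :=
  ∀ (X : Type u) [Finite X], Set (Language X)

/-- A transducer from `X` to `Y` with state set `Q`: a directed graph on `Q` with edges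
`(source, (input, output), target)` labelled by elements of `X* × Y*`, with an initial vertex
and a set of terminal vertices. -/
structure Transducer (X : Type u) (Y : Type v) (Q : Type w) where
  edges : Set (Q × (List X × List Y) × Q)
  init : Q
  terminal : Set Q

/-- `T.Path p u v q`: there is a path from `p` to `q` whose label in `X* × Y*` is `(u, v)`. -/
inductive Transducer.Path {X : Type u} {Y : Type v} {Q : Type w} (T : Transducer X Y Q) :
    Q → List X → List Y → Q → Prop
  | nil (p : Q) : T.Path p [] [] p
  | cons {p q r : Q} {a u : List X} {b v : List Y} (he : (p, (a, b), q) ∈ T.edges)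
      (hp : T.Path q u v r) : T.Path p (a ++ u) (b ++ v) r

/-- The relation accepted by a transducer. -/
def Transducer.Accepts {X : Type u} {Y : Type v} {Q : Type w} (T : Transducer X Y Q)
    (x : List X) (y : List Y) : Prop :=
  ∃ q ∈ T.terminal, T.Path T.init x y q

/-- A relation between words over `X` and words over `Y` is a rational transduction if it is
accepted by a finite transducer. -/
def IsRationalTransduction {X : Type u} {Y : Type v} (ρ : List X → List Y → Prop) : Prop :=
  ∃ (Q : Type) (_ : Finite Q) (T : Transducer X Y Q),
    T.edges.Finite ∧ ∀ x y, ρ x y ↔ T.Accepts x y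

/-- The image `Lρ` of a language under a relation. -/
def transductionImage {X : Type u} {Y : Type v} (L : Language X) (ρ : List X → List Y → Prop) :
    Language Y :=
  {y | ∃ x ∈ L, ρ x y}

/-- Closure of a family of languages under rational transductions. -/
def LanguageFamily.ClosedUnderRationalTransduction (F : LanguageFamily.{u}) : Prop :=
  ∀ (X Y : Type u) [Finite X] [Finite Y] (ρ : List X → List Y → Prop) (L : Language X),
    IsRationalTransduction ρ → L ∈ F X → transductionImage L ρ ∈ F Y

/-- Closure of a family of languages under Kleene closure `L ↦ L*`. -/
def LanguageFamily.ClosedUnderKleeneClosure (F : LanguageFamily.{u}) : Prop :=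
  ∀ (X : Type u) [Finite X] (L : Language X), L ∈ F X → L∗ ∈ F X

/-! ### Loop problems and word problems -/

/-- The loop automaton of a monoid `M` with respect to a choice of generators `σ : X* → M`.
The alphabet is `X ⊕ X`, where `Sum.inl x` is the generator `x` and `Sum.inr x` is its formal
inverse. The vertices are the elements of `M`; `a * xσ = b` gives an edge from `a` to `b`
labelled `x` and an edge from `b` to `a` labelled by the formal inverse of `x`. The start vertex
and the terminal vertex are the identity. The state set may be infinite. -/
def loopAutomaton {X : Type u} {M : Type v} [Monoid M] (σ : FreeMonoid X →* M) :
    NFA (X ⊕ X) M where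
  step a s := match s with
    | Sum.inl x => {b | a * σ (FreeMonoid.of x) = b}
    | Sum.inr x => {b | b * σ (FreeMonoid.of x) = a}
  start := {1}
  accept := {1}

/-- The loop problem of a monoid with respect to a choice of monoid generators. -/
def monoidLoopProblem {X : Type u} {M : Type v} [Monoid M] (σ : FreeMonoid X →* M) :
    Language (X ⊕ X) :=
  (loopAutomaton σ).accepts

/-- The extension `σ¹ : X* → S¹` of a morphism `σ : X⁺ → S`, where `S¹` is `S` with a new
identity element adjoined (even if `S` already has an identity). -/
def extendOne {X : Type u} {S : Type v} [Semigroup S] (σ : FreeSemigroup X →ₙ* S) :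
    FreeMonoid X →* WithOne S :=
  FreeMonoid.lift fun x => ((σ (FreeSemigroup.of x) : S) : WithOne S)

/-- The loop problem of a semigroup with respect to a choice of semigroup generators. -/
def semigroupLoopProblem {X : Type u} {S : Type v} [Semigroup S] (σ : FreeSemigroup X →ₙ* S) :
    Language (X ⊕ X) :=
  monoidLoopProblem (extendOne σ)

/-- The word problem of a group with respect to a choice of monoid generators. -/
def wordProblem {X : Type u} {G : Type v} [Group G] (σ : FreeMonoid X →* G) : Language X :=
  {x | σ (FreeMonoid.ofList x) = 1}

/-- A semigroup is finitely generated if it admits a finite choice of semigroup generators. -/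
def IsFinitelyGeneratedSemigroup (S : Type v) [Semigroup S] : Prop :=
  ∃ (X : Type u) (_ : Finite X) (σ : FreeSemigroup X →ₙ* S), Function.Surjective σ

/-! ### Completely simple semigroups and maximal subgroups -/

/-- `z` is a zero element of the semigroup `S`. -/
def IsZeroElement {S : Type v} [Semigroup S] (z : S) : Prop :=
  ∀ s : S, s * z = z ∧ z * s = z

/-- A primitive idempotent: an idempotent `e` such that `e = f` for every non-zero idempotent
`f` with `ef = fe = f`. -/
def IsPrimitiveIdempotent {S : Type v} [Semigroup S] (e : S) : Prop :=
  IsIdempotentElem e ∧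
    ∀ f : S, IsIdempotentElem f → ¬ IsZeroElement f → e * f = f → f * e = f → e = f

/-- A (two-sided, non-empty) ideal of a semigroup. -/
def IsSemigroupIdeal {S : Type v} [Semigroup S] (I : Set S) : Prop :=
  I.Nonempty ∧ ∀ a ∈ I, ∀ s : S, s * a ∈ I ∧ a * s ∈ I

/-- A semigroup is completely simple if it has a primitive idempotent and no proper ideals. -/
def IsCompletelySimple (S : Type v) [Semigroup S] : Prop :=
  (∃ e : S, IsPrimitiveIdempotent e) ∧ ∀ I : Set S, IsSemigroupIdeal I → I = Set.univ

/-- A subgroup of a semigroup `S`: a subsemigroup that is a group under the multiplication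
inherited from `S`. (The identity element `e` is determined by the underlying set.) -/
structure SemigroupSubgroup (S : Type v) [Semigroup S] extends Subsemigroup S where
  e : S
  e_mem : e ∈ carrier
  e_mul : ∀ x ∈ carrier, e * x = x
  mul_e : ∀ x ∈ carrier, x * e = x
  exists_inv : ∀ x ∈ carrier, ∃ y ∈ carrier, x * y = e ∧ y * x = e

/-- The group structure of a subgroup of a semigroup, with the inherited multiplication. -/
noncomputable instance SemigroupSubgroup.instGroup {S : Type v} [Semigroup S]
    (H : SemigroupSubgroup S) : Group H.toSubsemigroup where
  mul_assoc := mul_assoc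
  one := ⟨H.e, H.e_mem⟩
  one_mul x := Subtype.ext (H.e_mul x.1 x.2)
  mul_one x := Subtype.ext (H.mul_e x.1 x.2)
  inv x := ⟨(H.exists_inv x.1 x.2).choose, (H.exists_inv x.1 x.2).choose_spec.1⟩
  inv_mul_cancel x := Subtype.ext (H.exists_inv x.1 x.2).choose_spec.2.2

/-- A subgroup of a semigroup is maximal if it is not properly contained in another subgroup. -/
def SemigroupSubgroup.IsMaximal {S : Type v} [Semigroup S] (H : SemigroupSubgroup S) : Prop :=
  ∀ K : SemigroupSubgroup S, H.toSubsemigroup ≤ K.toSubsemigroup →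
    K.toSubsemigroup = H.toSubsemigroup

/-! ### Membership in a family, for some or for every finite choice of generators -/

/-- For some finite choice of semigroup generators, the loop problem of `S` belongs to `F`. -/
def SomeSemigroupLoopProblemIn (F : LanguageFamily.{u}) (S : Type v) [Semigroup S] : Prop :=
  ∃ (X : Type u) (_ : Finite X) (σ : FreeSemigroup X →ₙ* S),
    Function.Surjective σ ∧ semigroupLoopProblem σ ∈ F (X ⊕ X)

/-- For every finite choice of semigroup generators, the loop problem of `S` belongs to `F`. -/
def EverySemigroupLoopProblemIn (F : LanguageFamily.{u}) (S : Type v) [Semigroup S] : Prop :=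
  ∀ (X : Type u) [Finite X] (σ : FreeSemigroup X →ₙ* S),
    Function.Surjective σ → semigroupLoopProblem σ ∈ F (X ⊕ X)

/-- For some finite choice of monoid generators, the loop problem of `M` belongs to `F`. -/
def SomeMonoidLoopProblemIn (F : LanguageFamily.{u}) (M : Type v) [Monoid M] : Prop :=
  ∃ (X : Type u) (_ : Finite X) (σ : FreeMonoid X →* M),
    Function.Surjective σ ∧ monoidLoopProblem σ ∈ F (X ⊕ X)

/-- For every finite choice of monoid generators, the loop problem of `M` belongs to `F`. -/
def EveryMonoidLoopProblemIn (F : LanguageFamily.{u}) (M : Type v) [Monoid M] : Prop :=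
  ∀ (X : Type u) [Finite X] (σ : FreeMonoid X →* M),
    Function.Surjective σ → monoidLoopProblem σ ∈ F (X ⊕ X)

/-- For some finite choice of monoid generators, the word problem of `G` belongs to `F`. -/
def SomeWordProblemIn (F : LanguageFamily.{u}) (G : Type v) [Group G] : Prop :=
  ∃ (X : Type u) (_ : Finite X) (σ : FreeMonoid X →* G),
    Function.Surjective σ ∧ wordProblem σ ∈ F X

/-- For every finite choice of monoid generators, the word problem of `G` belongs to `F`. -/
def EveryWordProblemIn (F : LanguageFamily.{u}) (G : Type v) [Group G] : Prop :=
  ∀ (X : Type u) [Finite X] (σ : FreeMonoid X →* G),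
    Function.Surjective σ → wordProblem σ ∈ F X

/-! A completely simple semigroup `S` is a Rees matrix semigroup over any maximal subgroup `G`: an
element is a triple (row, value in `G`, column), and in a product the values are multiplied with a
sandwich entry between them. Finite generation makes the sets of rows and columns finite.

From `G` to `S`: in the graph of `S¹`, a loop at the adjoined identity splits into first returns, so
the loop problem is the Kleene closure of the first return language
(`semigroupLoopProblem_eq_kstar`). Between its ends a first return stays inside `S`. A finite
automaton can remember the row and column of the current vertex, and the value is the product of the
weights in `G` read so far (`ReesCoordinates.weightedPath_iff`). Closing up means total weight `1`,
and the labels of such paths form a rational image of the word problem of `G`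
(`weightedPath_one_mem`).

From `S` to `G`: substitute words over the generators of `S` for those of `G`, walk out to the
idempotent `e` of `G`, multiply, and walk back along the same word for `e`. The walk closes exactly
when the product is `1` (`SomeSemigroupLoopProblemIn.everyWordProblemIn`).

A group is a Rees matrix semigroup with one row and one column, so both directions also settle its
semigroup loop problem. Its monoid loop problem is its word problem for generators together with
their inverses. -/

/-! ### Rational transductions -/

/-- The state set of a finite transducer may live in any universe. -/
theorem Transducer.isRationalTransduction {X : Type u} {Y : Type v} {Q : Type w} [Finite Q]
    (T : Transducer X Y Q) (hT : T.edges.Finite) : IsRationalTransduction T.Accepts := by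
  obtain ⟨n, ⟨f⟩⟩ := Finite.exists_equiv_fin Q
  let T' : Transducer X Y (Fin n) :=
    { edges := (fun e => (f e.1, e.2.1, f e.2.2)) '' T.edges
      init := f T.init
      terminal := f '' T.terminal }
  have h1 : ∀ {p u v q}, T.Path p u v q → T'.Path (f p) u v (f q) := by
    intro p u v q h
    induction h with
    | nil p => exact .nil _
    | cons he _ ih => exact .cons ⟨_, he, rfl⟩ ih
  have h2 : ∀ {p u v q}, T'.Path p u v q → T.Path (f.symm p) u v (f.symm q) := by
    intro p u v q h
    induction h with
    | nil p => exact .nil _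
    | cons he _ ih =>
      obtain ⟨⟨p', ab, q'⟩, he, heq⟩ := he
      simp only [Prod.mk.injEq] at heq
      obtain ⟨rfl, rfl, rfl⟩ := heq
      rw [f.symm_apply_apply] at ih ⊢
      exact .cons he ih
  refine ⟨Fin n, inferInstance, T', hT.image _, fun x y => ⟨?_, ?_⟩⟩
  · rintro ⟨q, hq, h⟩
    exact ⟨f q, ⟨q, hq, rfl⟩, h1 h⟩
  · rintro ⟨_, ⟨q, hq, rfl⟩, h⟩
    have := h2 h
    rw [f.symm_apply_apply, f.symm_apply_apply] at this
    exact ⟨q, hq, this⟩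

theorem LanguageFamily.ClosedUnderRationalTransduction.image_mem {F : LanguageFamily.{u}}
    (hF : F.ClosedUnderRationalTransduction) {X Y : Type u} [Finite X] [Finite Y] {Q : Type w}
    [Finite Q] (T : Transducer X Y Q) (hT : T.edges.Finite) {L : Language X} (hL : L ∈ F X) :
    transductionImage L T.Accepts ∈ F Y :=
  hF X Y _ L (T.isRationalTransduction hT) hL

/-- The transducer that reads `a`, then the word `φ z` for each letter `z` that it writes, and
finally `c`. -/
def Transducer.bracketed {X : Type u} {Z : Type v} (φ : Z → List X) (a c : List X) :
    Transducer X Z (Option Bool) where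
  edges := {(none, (a, []), some false), (some false, (c, []), some true)} ∪
    Set.range fun z => (some false, (φ z, [z]), some false)
  init := none
  terminal := {some true}

theorem Transducer.bracketed_accepts {X : Type u} {Z : Type v} (φ : Z → List X) (a c : List X)
    (u : List X) (v : List Z) :
    (Transducer.bracketed φ a c).Accepts u v ↔ u = a ++ (v.flatMap φ ++ c) := by
  set T := Transducer.bracketed φ a c
  have h2 : ∀ {p u v q}, T.Path p u v q → p = some true → u = [] ∧ v = [] := by
    intro p u v q h hp
    cases h with
    | nil => exact ⟨rfl, rfl⟩
    | cons he _ =>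
      subst hp
      simp [T, Transducer.bracketed] at he
  have h1 : ∀ {p u v q}, T.Path p u v q → p = some false → q = some true →
      u = v.flatMap φ ++ c := by
    intro p u v q h
    induction h with
    | nil p => rintro rfl h; simp at h
    | cons he hp ih =>
      rintro rfl hq
      simp only [T, Transducer.bracketed, Set.mem_union, Set.mem_insert_iff,
        Set.mem_singleton_iff, Set.mem_range, Prod.mk.injEq, reduceCtorEq, false_and, false_or,
        true_and] at he
      rcases he with ⟨⟨rfl, rfl⟩, rfl⟩ | ⟨z, ⟨rfl, rfl⟩, rfl⟩
      · obtain ⟨rfl, rfl⟩ := h2 hp rfl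
        simp
      · simp [ih rfl hq]
  constructor
  · rintro ⟨q, rfl, h⟩
    generalize hp : T.init = p at h
    generalize hq : some true = q at h
    cases h with
    | nil => subst hp; simp [T, Transducer.bracketed] at hq
    | cons he h =>
      subst hp
      simp only [T, Transducer.bracketed, Set.mem_union, Set.mem_insert_iff,
        Set.mem_singleton_iff, Set.mem_range, Prod.mk.injEq, reduceCtorEq, false_and, or_false,
        true_and, exists_false] at he
      obtain ⟨⟨rfl, rfl⟩, rfl⟩ := he
      simp [h1 h rfl hq.symm]
  · rintro rfl
    refine ⟨some true, rfl, ?_⟩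
    refine Transducer.Path.cons (b := []) (q := some false)
      (by simp [T, Transducer.bracketed]) ?_
    induction v with
    | nil =>
      have := Transducer.Path.cons (T := T) (p := some false) (a := c) (b := [])
        (by simp [T, Transducer.bracketed]) (.nil (some true))
      simpa using this
    | cons z v ih =>
      rw [List.flatMap_cons, List.append_assoc]
      exact Transducer.Path.cons (b := [z]) (q := some false)
        (by simp [T, Transducer.bracketed]) ih

/-- Closure under inverse morphisms followed by quotients by fixed words. -/
theorem LanguageFamily.ClosedUnderRationalTransduction.bracketed_mem {F : LanguageFamily.{u}}
    (hF : F.ClosedUnderRationalTransduction) {X Z : Type u} [Finite X] [Finite Z]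
    (φ : Z → List X) (a c : List X) {L : Language X} (hL : L ∈ F X) :
    ({v | a ++ (v.flatMap φ ++ c) ∈ L} : Language Z) ∈ F Z := by
  refine Set.mem_of_eq_of_mem ?_ (hF.image_mem (Transducer.bracketed φ a c)
    ((Set.toFinite _).union (Set.finite_range _)) hL)
  ext v
  simp only [transductionImage, Transducer.bracketed_accepts]
  exact ⟨fun h => ⟨_, h, rfl⟩, by rintro ⟨_, h, rfl⟩; exact h⟩

/-! ### Automata with weights in a group -/

/-- `WeightedPath step wt v p g q`: there is a path from `p` to `q` labelled `v` of weight `g`. -/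
def WeightedPath {Z : Type u} {Q : Type v} {G : Type w} [Monoid G] (step : Q → Z → Q → Prop)
    (wt : Q → Z → Q → G) : List Z → Q → G → Q → Prop
  | [], p, g, q => g = 1 ∧ p = q
  | z :: v, p, g, q => ∃ r h, step p z r ∧ g = wt p z r * h ∧ WeightedPath step wt v r h q

/-- If the word problem of `G` is in the family, then so is the language of all words labelling a
path of weight `1` between two given states of a finite `G`-weighted automaton. -/
theorem weightedPath_one_mem {F : LanguageFamily.{u}}
    (hF : F.ClosedUnderRationalTransduction) {G : Type w} [Group G] {Y Z : Type u} [Finite Y]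
    [Finite Z] {τ : FreeMonoid Y →* G} (hτ : Function.Surjective τ) (hL : wordProblem τ ∈ F Y)
    {Q : Type v} [Finite Q] (step : Q → Z → Q → Prop) (wt : Q → Z → Q → G) (p q : Q) :
    ({v | WeightedPath step wt v p 1 q} : Language Z) ∈ F Z := by
  have hτ' : ∀ g : G, ∃ y : List Y, τ (FreeMonoid.ofList y) = g := fun g => by
    obtain ⟨y, rfl⟩ := hτ g
    exact ⟨FreeMonoid.toList y, rfl⟩
  choose word hword using hτ'
  -- While writing a letter, the transducer reads a chosen word representing the weight of the step.
  -- The input word therefore evaluates to the weight of the path.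
  let T : Transducer Y Z Q :=
    { edges := (fun e : Q × Z × Q => (e.1, (word (wt e.1 e.2.1 e.2.2), [e.2.1]), e.2.2)) ''
        {e | step e.1 e.2.1 e.2.2}
      init := p
      terminal := {q} }
  have h1 : ∀ {p u v q}, T.Path p u v q →
      WeightedPath step wt v p (τ (FreeMonoid.ofList u)) q := by
    intro p u v q h
    induction h with
    | nil p => exact ⟨by simp, rfl⟩
    | cons he _ ih =>
      obtain ⟨⟨p', z, q'⟩, he, heq⟩ := he
      simp only [Prod.mk.injEq] at heq
      obtain ⟨rfl, ⟨rfl, rfl⟩, rfl⟩ := heq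
      exact ⟨q', _, he, by rw [FreeMonoid.ofList_append, map_mul, hword], ih⟩
  have h2 : ∀ (v : List Z) p g q, WeightedPath step wt v p g q →
      ∃ u, τ (FreeMonoid.ofList u) = g ∧ T.Path p u v q := by
    intro v
    induction v with
    | nil =>
      rintro p g q ⟨rfl, rfl⟩
      exact ⟨[], by simp, .nil p⟩
    | cons z v ih =>
      rintro p g q ⟨r, h, hs, rfl, hr⟩
      obtain ⟨u, rfl, hu⟩ := ih r h q hr
      exact ⟨word (wt p z r) ++ u, by rw [FreeMonoid.ofList_append, map_mul, hword],
        Transducer.Path.cons (b := [z]) ⟨(p, z, r), hs, rfl⟩ hu⟩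
  refine Set.mem_of_eq_of_mem ?_ (hF.image_mem T ((Set.toFinite _).image _) hL)
  ext v
  constructor
  · intro h
    obtain ⟨u, hu, hp⟩ := h2 v _ _ _ h
    exact ⟨u, hu, q, rfl, hp⟩
  · rintro ⟨u, hu, q', hq', hp⟩
    have := h1 hp
    rwa [show τ (FreeMonoid.ofList u) = 1 from hu, show q' = q from hq'] at this

/-! ### Paths in loop automata -/

/-- `LoopPath τ w a b`: the word `w` labels a path from `a` to `b` in the graph that has an edge
from `a` to `a * τ x` labelled `x` and an inverse edge labelled by the formal inverse of `x`. -/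
def LoopPath {X : Type u} {M : Type v} [Mul M] (τ : X → M) : List (X ⊕ X) → M → M → Prop
  | [], a, b => a = b
  | Sum.inl x :: w, a, b => LoopPath τ w (a * τ x) b
  | Sum.inr x :: w, a, b => ∃ c, c * τ x = a ∧ LoopPath τ w c b

theorem mem_loopAutomaton_evalFrom {X : Type u} {M : Type v} [Monoid M] (σ : FreeMonoid X →* M)
    (w : List (X ⊕ X)) (A : Set M) (b : M) :
    b ∈ (loopAutomaton σ).evalFrom A w ↔
      ∃ a ∈ A, LoopPath (fun x => σ (FreeMonoid.of x)) w a b := by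
  induction w generalizing A with
  | nil => simp [LoopPath]
  | cons z w ih =>
    rw [NFA.evalFrom_cons, ih]
    rcases z with x | x
    · simp [NFA.mem_stepSet, loopAutomaton, LoopPath]
    · simp only [NFA.mem_stepSet, loopAutomaton, LoopPath, Set.mem_ofPred_eq]
      constructor
      · rintro ⟨c, ⟨a, ha, hc⟩, h⟩
        exact ⟨a, ha, c, hc, h⟩
      · rintro ⟨a, ha, c, hc, h⟩
        exact ⟨c, ⟨a, ha, hc⟩, h⟩

theorem mem_monoidLoopProblem {X : Type u} {M : Type v} [Monoid M] (σ : FreeMonoid X →* M)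
    (w : List (X ⊕ X)) :
    w ∈ monoidLoopProblem σ ↔ LoopPath (fun x => σ (FreeMonoid.of x)) w 1 1 := by
  rw [monoidLoopProblem, NFA.mem_accepts]
  have := mem_loopAutomaton_evalFrom σ w {1} 1
  simpa [loopAutomaton] using this

theorem mem_semigroupLoopProblem {X : Type u} {S : Type v} [Semigroup S]
    (σ : FreeSemigroup X →ₙ* S) (w : List (X ⊕ X)) :
    w ∈ semigroupLoopProblem σ ↔
      LoopPath (fun x => ((σ (FreeSemigroup.of x) : S) : WithOne S)) w 1 1 := by
  simp [semigroupLoopProblem, mem_monoidLoopProblem, extendOne]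

theorem loopPath_append {X : Type u} {M : Type v} [Mul M] (τ : X → M) (w w' : List (X ⊕ X))
    (a b : M) : LoopPath τ (w ++ w') a b ↔ ∃ c, LoopPath τ w a c ∧ LoopPath τ w' c b := by
  induction w generalizing a with
  | nil => simp [LoopPath]
  | cons z w ih =>
    rcases z with x | x
    · simp only [List.cons_append, LoopPath, ih]
    · simp only [List.cons_append, LoopPath, ih]
      constructor
      · rintro ⟨d, hd, c, h, h'⟩
        exact ⟨c, ⟨d, hd, h⟩, h'⟩
      · rintro ⟨c, ⟨d, hd, h⟩, h'⟩
        exact ⟨d, hd, c, h, h'⟩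

theorem loopPath_map_inl {X : Type u} {M : Type v} [Monoid M] (τ : X → M) (w : List X) (a b : M) :
    LoopPath τ (w.map Sum.inl) a b ↔ a * (w.map τ).prod = b := by
  induction w generalizing a with
  | nil => simp [LoopPath]
  | cons x w ih => simp [LoopPath, ih, mul_assoc]

/-- Such a word walks backwards along the path labelled `w`, hence the exchanged roles of `a` and
`b`. -/
theorem loopPath_map_inr {X : Type u} {M : Type v} [Monoid M] (τ : X → M) (w : List X) (a b : M) :
    LoopPath τ (w.reverse.map Sum.inr) a b ↔ b * (w.map τ).prod = a := by
  induction w generalizing b with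
  | nil => simp [LoopPath, eq_comm]
  | cons x w ih =>
    rw [List.reverse_cons, List.map_append, loopPath_append]
    simp only [ih]
    simp [LoopPath, mul_assoc]

/-- The map of path graphs induced by a morphism. -/
theorem LoopPath.map {X : Type u} {M : Type v} {N : Type w} [Mul M] [Mul N] {τ : X → M}
    (f : M →ₙ* N) {v : List (X ⊕ X)} {a b : M} (h : LoopPath τ v a b) :
    LoopPath (fun x => f (τ x)) v (f a) (f b) := by
  induction v generalizing a with
  | nil => exact congrArg f h
  | cons z v ih =>
    rcases z with x | x
    · have := ih h
      rwa [map_mul] at this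
    · obtain ⟨c, rfl, h⟩ := h
      exact ⟨f c, (map_mul f _ _).symm, ih h⟩

/-! ### The loop problem of a semigroup as a Kleene closure -/

/-- The labels of the paths in the graph of `S¹` that leave the adjoined identity and come back to
it at the end only. -/
def firstReturnLanguage {X : Type u} {S : Type v} [Mul S] (τ : X → S) : Language (X ⊕ X) :=
  {v | ∃ x u y, v = Sum.inl x :: (u ++ [Sum.inr y]) ∧ LoopPath τ u (τ x) (τ y)}

/-- No product with a generator is the adjoined identity. It can therefore be left only along a
positive edge to some `τ x`, and entered only along an inverse edge from some `τ y`; cutting a loop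
at its visits to the identity gives first returns. -/
theorem semigroupLoopProblem_eq_kstar {X : Type u} {S : Type v} [Semigroup S]
    (σ : FreeSemigroup X →ₙ* S) :
    semigroupLoopProblem σ = (firstReturnLanguage fun x => σ (FreeSemigroup.of x))∗ := by
  set τ : X → S := fun x => σ (FreeSemigroup.of x) with hτ
  -- Paths starting at the identity and paths starting inside `S` need each other in the induction;
  -- the latter are cut at their first arrival at the identity.
  have key : ∀ w : List (X ⊕ X),
      (LoopPath (fun x => (τ x : WithOne S)) w 1 1 → w ∈ (firstReturnLanguage τ)∗) ∧
      ∀ s : S, LoopPath (fun x => (τ x : WithOne S)) w s 1 →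
        ∃ u y w', w = u ++ Sum.inr y :: w' ∧ LoopPath τ u s (τ y) ∧
          w' ∈ (firstReturnLanguage τ)∗ := by
    intro w
    induction w with
    | nil => exact ⟨fun _ => Language.nil_mem_kstar _, fun s h => (WithOne.coe_ne_one h).elim⟩
    | cons z w ih =>
      rcases z with x | x
      · constructor
        · intro h
          rw [LoopPath, one_mul] at h
          obtain ⟨u, y, w', rfl, hu, hw'⟩ := ih.2 _ h
          rw [← Language.one_add_self_mul_kstar_eq_kstar]
          refine Or.inr ⟨_, ⟨x, u, y, rfl, hu⟩, w', hw', by simp⟩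
        · intro s h
          rw [LoopPath, ← WithOne.coe_mul] at h
          obtain ⟨u, y, w', rfl, hu, hw'⟩ := ih.2 _ h
          exact ⟨Sum.inl x :: u, y, w', rfl, hu, hw'⟩
      · constructor
        · rintro ⟨c, hc, -⟩
          exfalso
          cases c using WithOne.recOneCoe with
          | one => rw [one_mul] at hc; exact WithOne.coe_ne_one hc
          | coe c => rw [← WithOne.coe_mul] at hc; exact WithOne.coe_ne_one hc
        · rintro s ⟨c, hc, h⟩
          cases c using WithOne.recOneCoe with
          | one =>
            rw [one_mul, WithOne.coe_inj] at hc
            exact ⟨[], x, w, rfl, hc.symm, ih.1 h⟩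
          | coe c =>
            rw [← WithOne.coe_mul, WithOne.coe_inj] at hc
            obtain ⟨u, y, w', rfl, hu, hw'⟩ := ih.2 _ h
            exact ⟨Sum.inr x :: u, y, w', rfl, ⟨c, hc, hu⟩, hw'⟩
  ext w
  rw [mem_semigroupLoopProblem]
  refine ⟨(key w).1, ?_⟩
  rintro ⟨l, rfl, hl⟩
  induction l with
  | nil => exact rfl
  | cons v l ih =>
    rw [List.flatten_cons, loopPath_append]
    refine ⟨1, ?_, ih fun y hy => hl y (List.mem_cons_of_mem _ hy)⟩
    obtain ⟨x, u, y, rfl, hu⟩ := hl v List.mem_cons_self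
    rw [LoopPath, one_mul, loopPath_append]
    exact ⟨_, hu.map (WithOne.coeMulHom : S →ₙ* WithOne S), 1, one_mul _, rfl⟩

/-! ### Word problems of groups -/

theorem mem_wordProblem {X : Type u} {G : Type v} [Group G] (σ : FreeMonoid X →* G)
    (w : List X) : w ∈ wordProblem σ ↔ σ (FreeMonoid.ofList w) = 1 := Iff.rfl

theorem SomeWordProblemIn.every {F : LanguageFamily.{u}}
    (hF : F.ClosedUnderRationalTransduction) {G : Type v} [Group G]
    (h : SomeWordProblemIn F G) : EveryWordProblemIn F G := by
  obtain ⟨X, _, σ, hσ, hL⟩ := h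
  intro Z _ τ _
  have hσ' : ∀ z : Z, ∃ y : List X, σ (FreeMonoid.ofList y) = τ (FreeMonoid.of z) := fun z => by
    obtain ⟨y, hy⟩ := hσ (τ (FreeMonoid.of z))
    exact ⟨FreeMonoid.toList y, hy⟩
  choose φ hφ using hσ'
  refine Set.mem_of_eq_of_mem ?_ (hF.bracketed_mem φ [] [] hL)
  ext v
  have : σ (FreeMonoid.ofList (v.flatMap φ)) = τ (FreeMonoid.ofList v) := by
    induction v with
    | nil => simp
    | cons z v ih =>
      rw [List.flatMap_cons, FreeMonoid.ofList_append, map_mul, ih, hφ, FreeMonoid.ofList_cons,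
        map_mul]
  change _ ↔ [] ++ (v.flatMap φ ++ []) ∈ wordProblem σ
  rw [List.nil_append, List.append_nil, mem_wordProblem, mem_wordProblem, this]

/-- The loop problem of a group is its word problem for the generators and their inverses. -/
theorem monoidLoopProblem_eq_wordProblem {X : Type u} {G : Type v} [Group G]
    (σ : FreeMonoid X →* G) :
    monoidLoopProblem σ = wordProblem (FreeMonoid.lift (Sum.elim
      (fun x => σ (FreeMonoid.of x)) fun x => (σ (FreeMonoid.of x))⁻¹)) := by
  ext w
  rw [mem_monoidLoopProblem, mem_wordProblem]
  have : ∀ a b, LoopPath (fun x => σ (FreeMonoid.of x)) w a b ↔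
      a * FreeMonoid.lift (Sum.elim (fun x => σ (FreeMonoid.of x))
        fun x => (σ (FreeMonoid.of x))⁻¹) (FreeMonoid.ofList w) = b := by
    induction w with
    | nil => simp [LoopPath]
    | cons z w ih =>
      intro a b
      rcases z with x | x
      · simp [LoopPath, ih, FreeMonoid.ofList_cons, mul_assoc]
      · simp only [LoopPath, ih, FreeMonoid.ofList_cons, map_mul, FreeMonoid.lift_eval_of,
          Sum.elim_inr, ← mul_assoc]
        constructor
        · rintro ⟨c, rfl, rfl⟩
          rw [mul_inv_cancel_right]
        · intro h
          exact ⟨_, inv_mul_cancel_right _ _, h⟩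
  rw [this, one_mul]

theorem surjective_lift_elim {X : Type u} {G : Type v} [Group G] {σ : FreeMonoid X →* G}
    (hσ : Function.Surjective σ) : Function.Surjective (FreeMonoid.lift (Sum.elim
      (fun x => σ (FreeMonoid.of x)) fun x => (σ (FreeMonoid.of x))⁻¹)) := by
  intro g
  obtain ⟨y, rfl⟩ := hσ g
  refine ⟨FreeMonoid.map Sum.inl y, ?_⟩
  rw [← MonoidHom.comp_apply]
  congr 1
  ext x
  simp

theorem EveryWordProblemIn.everyMonoidLoopProblemIn {F : LanguageFamily.{u}} {G : Type v}
    [Group G] (h : EveryWordProblemIn F G) : EveryMonoidLoopProblemIn F G := by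
  intro X _ σ hσ
  rw [monoidLoopProblem_eq_wordProblem]
  exact h _ _ (surjective_lift_elim hσ)

theorem SomeMonoidLoopProblemIn.someWordProblemIn {F : LanguageFamily.{u}} {G : Type v}
    [Group G] (h : SomeMonoidLoopProblemIn F G) : SomeWordProblemIn F G := by
  obtain ⟨X, _, σ, hσ, hL⟩ := h
  rw [monoidLoopProblem_eq_wordProblem] at hL
  exact ⟨_, inferInstance, _, surjective_lift_elim hσ, hL⟩

theorem exists_list_prod_eq {X : Type u} {S : Type v} [Semigroup S]
    {σ : FreeSemigroup X →ₙ* S} (hσ : Function.Surjective σ) (s : S) :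
    ∃ l : List X, (l.map fun x => ((σ (FreeSemigroup.of x) : S) : WithOne S)).prod = s := by
  obtain ⟨w, rfl⟩ := hσ s
  induction w using FreeSemigroup.recOnMul with
  | ih1 x => exact ⟨[x], by simp⟩
  | ih2 x y _ hy =>
    obtain ⟨l, hl⟩ := hy
    exact ⟨x :: l, by simp [hl]⟩

/-- The word problem of a group embedded in a semigroup is obtained from the loop problem of the
semigroup by a rational transduction. -/
theorem SomeSemigroupLoopProblemIn.everyWordProblemIn {F : LanguageFamily.{u}}
    (hF : F.ClosedUnderRationalTransduction) {S : Type v} [Semigroup S]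
    (h : SomeSemigroupLoopProblemIn F S) {G : Type w} [Group G] (ι : G →ₙ* S)
    (hι : Function.Injective ι) : EveryWordProblemIn F G := by
  obtain ⟨X, _, σ, hσ, hL⟩ := h
  intro Z _ τ _
  choose word hword using exists_list_prod_eq hσ
  -- The opening bracket leads from the adjoined identity to `ι 1`. The closing bracket is the same
  -- word walked backwards, and it ends at the adjoined identity only from `ι 1`.
  refine Set.mem_of_eq_of_mem ?_ (hF.bracketed_mem
    (fun z => (word (ι (τ (FreeMonoid.of z)))).map Sum.inl)
    ((word (ι 1)).map Sum.inl) ((word (ι 1)).reverse.map Sum.inr) hL)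
  ext v
  have key : ∀ g : G, LoopPath (fun x => ((σ (FreeSemigroup.of x) : S) : WithOne S))
      (v.flatMap (fun z => (word (ι (τ (FreeMonoid.of z)))).map Sum.inl) ++
        (word (ι 1)).reverse.map Sum.inr) (ι g) 1 ↔ g * τ (FreeMonoid.ofList v) = 1 := by
    induction v with
    | nil =>
      intro g
      rw [List.flatMap_nil, List.nil_append, loopPath_map_inr, hword, one_mul, WithOne.coe_inj,
        hι.eq_iff]
      simp [eq_comm]
    | cons z v ih =>
      intro g
      rw [List.flatMap_cons, List.append_assoc, loopPath_append]
      simp only [loopPath_map_inl, hword, exists_eq_left', ← WithOne.coe_mul, ← map_mul]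
      rw [ih, FreeMonoid.ofList_cons, map_mul, mul_assoc]
  change _ ↔ _ ++ (_ ++ _) ∈ semigroupLoopProblem σ
  rw [mem_semigroupLoopProblem, loopPath_append]
  simp only [loopPath_map_inl, hword, exists_eq_left', one_mul]
  rw [key, one_mul, mem_wordProblem]

/-! ### Rees coordinates -/

/-- Coordinates that identify the semigroup `S` with the Rees matrix semigroup over the group `G`
with index sets `I`, `Λ` and sandwich matrix `entry`. -/
structure ReesCoordinates (S : Type u) (G : Type v) (I Λ : Type*) [Semigroup S] [Group G] where
  row : S → I
  val : S → G
  col : S → Λ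
  entry : Λ → I → G
  point : I → G → Λ → S
  row_point : ∀ i g k, row (point i g k) = i
  val_point : ∀ i g k, val (point i g k) = g
  col_point : ∀ i g k, col (point i g k) = k
  point_eta : ∀ s, point (row s) (val s) (col s) = s
  row_mul : ∀ s t, row (s * t) = row s
  val_mul : ∀ s t, val (s * t) = val s * entry (col s) (row t) * val t
  col_mul : ∀ s t, col (s * t) = col t

namespace ReesCoordinates

/-- A group has Rees coordinates over itself, with one row and one column. -/
def ofGroup (G : Type v) [Group G] : ReesCoordinates G G Unit Unit where
  row _ := ()
  val g := g
  col _ := ()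
  entry _ _ := 1
  point _ g _ := g
  row_point _ _ _ := rfl
  val_point _ _ _ := rfl
  col_point _ _ _ := rfl
  point_eta _ := rfl
  row_mul _ _ := rfl
  val_mul s t := by rw [mul_one]
  col_mul _ _ := rfl

end ReesCoordinates

namespace ReesCoordinates

variable {S : Type v} {G : Type w} {I Λ : Type*} [Semigroup S] [Group G] {X : Type u}

theorem ext (R : ReesCoordinates S G I Λ) {s t : S} (hrow : R.row s = R.row t)
    (hval : R.val s = R.val t) (hcol : R.col s = R.col t) : s = t := by
  rw [← R.point_eta s, hrow, hval, hcol, R.point_eta]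

/-- The row of a product is the row of its first letter. Likewise the column is that of the last
letter, so finitely many generators allow only finitely many rows and columns. -/
theorem row_surjective (R : ReesCoordinates S G I Λ) {σ : FreeSemigroup X →ₙ* S}
    (hσ : Function.Surjective σ) [Nonempty S] :
    Function.Surjective fun x => R.row (σ (FreeSemigroup.of x)) := by
  intro i
  obtain ⟨s₀⟩ := ‹Nonempty S›
  obtain ⟨w, hw⟩ := hσ (R.point i 1 (R.col s₀))
  have hi : R.row (σ w) = i := by rw [hw, R.row_point]
  induction w using FreeSemigroup.recOnMul generalizing i s₀ with
  | ih1 x => exact ⟨x, hi⟩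
  | ih2 x y _ _ => exact ⟨x, by rwa [map_mul, R.row_mul] at hi⟩

theorem col_surjective (R : ReesCoordinates S G I Λ) {σ : FreeSemigroup X →ₙ* S}
    (hσ : Function.Surjective σ) [Nonempty S] :
    Function.Surjective fun x => R.col (σ (FreeSemigroup.of x)) := by
  intro k
  obtain ⟨s₀⟩ := ‹Nonempty S›
  obtain ⟨w, hw⟩ := hσ (R.point (R.row s₀) 1 k)
  have hk : R.col (σ w) = k := by rw [hw, R.col_point]
  clear hw
  induction w using FreeSemigroup.recOnMul with
  | ih1 x => exact ⟨x, hk⟩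
  | ih2 x y _ ih => exact ih (by rwa [map_mul, R.col_mul] at hk)

/-- The structure group of a finitely generated Rees matrix semigroup is finitely generated. -/
theorem isFinitelyGeneratedSemigroup [Nonempty S] (R : ReesCoordinates S G I Λ)
    (h : IsFinitelyGeneratedSemigroup.{u} S) : IsFinitelyGeneratedSemigroup.{u} G := by
  obtain ⟨X, _, σ, hσ⟩ := h
  -- The value of a word alternates values of letters with sandwich entries. As every row and column
  -- is that of a generator, the entries are indexed by pairs of letters.
  let σ' : FreeSemigroup (X ⊕ X × X) →ₙ* G := FreeSemigroup.lift (Sum.elim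
    (fun x => R.val (σ (FreeSemigroup.of x)))
    fun x => R.entry (R.col (σ (FreeSemigroup.of x.1))) (R.row (σ (FreeSemigroup.of x.2))))
  refine ⟨_, inferInstance, σ', fun g => ?_⟩
  obtain ⟨s₀⟩ := ‹Nonempty S›
  obtain ⟨w, hw⟩ := hσ (R.point (R.row s₀) g (R.col s₀))
  have hg : R.val (σ w) = g := by rw [hw, R.val_point]
  rw [← hg]
  clear hw hg
  induction w using FreeSemigroup.recOnMul with
  | ih1 x => exact ⟨FreeSemigroup.of (Sum.inl x), by simp [σ']⟩
  | ih2 x w _ ih =>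
    obtain ⟨v, hv⟩ := ih
    obtain ⟨y, hy⟩ := R.row_surjective hσ (R.row (σ w))
    refine ⟨FreeSemigroup.of (Sum.inl x) * FreeSemigroup.of (Sum.inr (x, y)) * v, ?_⟩
    rw [map_mul σ, R.val_mul, ← hy, map_mul, map_mul, hv]
    simp [σ']

/-- The steps of a weighted automaton for the first return language of a Rees matrix semigroup:
`Sum.inl false` is the initial state, `Sum.inl true` the final one. -/
def step (R : ReesCoordinates S G I Λ) (τ : X → S) :
    Bool ⊕ I × Λ → X ⊕ X → Bool ⊕ I × Λ → Prop
  | .inl false, .inl x, .inr q => q = (R.row (τ x), R.col (τ x))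
  | .inr p, .inl x, .inr q => q = (p.1, R.col (τ x))
  -- An inverse edge preserves the row but puts no condition on the new column, which is guessed.
  | .inr p, .inr x, .inr q => q.1 = p.1 ∧ p.2 = R.col (τ x)
  | .inr p, .inr x, .inl true => p = (R.row (τ x), R.col (τ x))
  | _, _, _ => False

/-- The weights of the steps in `ReesCoordinates.step`. -/
def weight (R : ReesCoordinates S G I Λ) (τ : X → S) :
    Bool ⊕ I × Λ → X ⊕ X → Bool ⊕ I × Λ → G
  | .inl _, .inl x, _ => R.val (τ x)
  | .inr p, .inl x, _ => R.entry p.2 (R.row (τ x)) * R.val (τ x)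
  -- This inverts the weight of the forward edge, so the entry involves the column of the target.
  | _, .inr x, .inr q => (R.entry q.2 (R.row (τ x)) * R.val (τ x))⁻¹
  | _, .inr x, .inl _ => (R.val (τ x))⁻¹

theorem not_weightedPath_final (R : ReesCoordinates S G I Λ) (τ : X → S) {v : List (X ⊕ X)}
    {g : G} (h : WeightedPath (R.step τ) (R.weight τ) v (.inl true) g (.inl true)) :
    v = [] ∧ g = 1 := by
  cases v with
  | nil => exact ⟨rfl, h.1⟩
  | cons z v =>
    obtain ⟨r, _, hr, -⟩ := h
    exact hr.elim

/-- On arrival at `s` the accumulated weight is `R.val s`, so a total weight of `1` leaves `(R.val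
s)⁻¹` for the rest of the path. -/
theorem weightedPath_iff (R : ReesCoordinates S G I Λ) (τ : X → S) (v : List (X ⊕ X)) (s : S) :
    WeightedPath (R.step τ) (R.weight τ) v (.inr (R.row s, R.col s)) (R.val s)⁻¹ (.inl true) ↔
      ∃ u y, v = u ++ [Sum.inr y] ∧ LoopPath τ u s (τ y) := by
  induction v generalizing s with
  | nil => simp [WeightedPath]
  | cons z v ih =>
    rcases z with x | x
    · have hr : (R.row (s * τ x), R.col (s * τ x)) = (R.row s, R.col (τ x)) := by
        rw [R.row_mul, R.col_mul]
      constructor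
      · rintro ⟨r, h, hstep, hwt, hp⟩
        rcases r with b | r
        · exact hstep.elim
        · obtain rfl : r = _ := hstep
          obtain rfl : h = (R.val (s * τ x))⁻¹ := by
            rw [R.val_mul, mul_assoc, mul_inv_rev, hwt]
            exact (inv_mul_cancel_left _ _).symm
          rw [← hr, ih] at hp
          obtain ⟨u, y, rfl, hu⟩ := hp
          exact ⟨Sum.inl x :: u, y, rfl, hu⟩
      · rintro ⟨u, y, hv, hu⟩
        cases u with
        | nil => simp at hv
        | cons z u =>
          rw [List.cons_append, List.cons.injEq] at hv
          obtain ⟨rfl, hv⟩ := hv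
          refine ⟨.inr (R.row s, R.col (τ x)), (R.val (s * τ x))⁻¹, rfl, ?_, ?_⟩
          · rw [R.val_mul, mul_assoc, mul_inv_rev]
            exact (mul_inv_cancel_left _ _).symm
          · rw [← hr, ih]
            exact ⟨u, y, hv, hu⟩
    · constructor
      · rintro ⟨r, h, hstep, hwt, hp⟩
        rcases r with b | r
        · cases b with
          | false => exact hstep.elim
          | true =>
            obtain ⟨rfl, rfl⟩ := R.not_weightedPath_final τ hp
            have hs : (R.row s, R.col s) = (R.row (τ x), R.col (τ x)) := hstep
            rw [Prod.mk.injEq] at hs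
            refine ⟨[], x, rfl, R.ext hs.1 (inv_injective ?_) hs.2⟩
            rw [hwt, mul_one]
            rfl
        · obtain ⟨i, k⟩ := r
          obtain ⟨rfl, hcol⟩ : i = R.row s ∧ R.col s = R.col (τ x) := hstep
          -- The guessed column `k` and the remaining weight `h` determine the vertex at the far end
          -- of the inverse edge.
          let c := R.point (R.row s) h⁻¹ k
          have hc : c * τ x = s := by
            apply R.ext
            · simp [c, R.row_mul, R.row_point]
            · rw [R.val_mul, R.val_point, R.col_point, ← inv_inj, hwt, mul_assoc, mul_inv_rev,
                inv_inv]
              rfl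
            · rw [R.col_mul, hcol]
          have hp' := (ih c).1 (by
            simpa [c, R.row_point, R.col_point, R.val_point] using hp)
          obtain ⟨u, y, rfl, hu⟩ := hp'
          exact ⟨Sum.inr x :: u, y, rfl, c, hc, hu⟩
      · rintro ⟨u, y, hv, hu⟩
        cases u with
        | nil =>
          simp only [List.nil_append, List.cons.injEq, Sum.inr.injEq] at hv
          obtain ⟨rfl, rfl⟩ := hv
          obtain rfl : s = τ x := hu
          exact ⟨.inl true, 1, rfl, (mul_one _).symm, rfl, rfl⟩
        | cons z u =>
          rw [List.cons_append, List.cons.injEq] at hv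
          obtain ⟨rfl, hv⟩ := hv
          obtain ⟨c, rfl, hu⟩ := hu
          refine ⟨.inr (R.row c, R.col c), (R.val c)⁻¹, ⟨(R.row_mul _ _).symm, R.col_mul _ _⟩,
            ?_, (ih c).2 ⟨u, y, hv, hu⟩⟩
          rw [R.val_mul, mul_assoc, mul_inv_rev]
          rfl

theorem weightedPath_initial_iff (R : ReesCoordinates S G I Λ) (τ : X → S) (v : List (X ⊕ X)) :
    WeightedPath (R.step τ) (R.weight τ) v (.inl false) 1 (.inl true) ↔
      v ∈ firstReturnLanguage τ := by
  constructor
  · intro hv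
    cases v with
    | nil => simp [WeightedPath] at hv
    | cons z v =>
      obtain ⟨r, h, hstep, hwt, hp⟩ := hv
      rcases z with x | x
      · rcases r with b | r
        · exact hstep.elim
        · obtain rfl : r = _ := hstep
          obtain rfl : h = (R.val (τ x))⁻¹ := eq_inv_of_mul_eq_one_right hwt.symm
          obtain ⟨u, y, rfl, hu⟩ := (R.weightedPath_iff τ v (τ x)).1 hp
          exact ⟨x, u, y, rfl, hu⟩
      · exact hstep.elim
  · rintro ⟨x, u, y, rfl, hu⟩
    exact ⟨.inr (R.row (τ x), R.col (τ x)), (R.val (τ x))⁻¹, rfl, (mul_inv_cancel _).symm,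
      (R.weightedPath_iff τ _ _).2 ⟨u, y, rfl, hu⟩⟩

theorem everySemigroupLoopProblemIn [Nonempty S] (R : ReesCoordinates S G I Λ)
    {F : LanguageFamily.{u}} (hF : F.ClosedUnderRationalTransduction)
    (hF' : F.ClosedUnderKleeneClosure) (h : SomeWordProblemIn F G) :
    EverySemigroupLoopProblemIn F S := by
  obtain ⟨Y, _, τ, hτ, hL⟩ := h
  intro X _ σ hσ
  have := Finite.of_surjective _ (R.row_surjective hσ)
  have := Finite.of_surjective _ (R.col_surjective hσ)
  rw [semigroupLoopProblem_eq_kstar]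
  refine hF' _ _ (Set.mem_of_eq_of_mem ?_ (weightedPath_one_mem hF hτ hL
    (R.step fun x => σ (FreeSemigroup.of x)) (R.weight fun x => σ (FreeSemigroup.of x))
    (.inl false) (.inl true)))
  ext v
  exact (R.weightedPath_initial_iff _ v).symm

end ReesCoordinates

/-! ### Finite choices of generators -/

theorem IsFinitelyGeneratedSemigroup.someSemigroupLoopProblemIn {S : Type v} [Semigroup S]
    {F : LanguageFamily.{u}} (h : IsFinitelyGeneratedSemigroup.{u} S)
    (hS : EverySemigroupLoopProblemIn F S) : SomeSemigroupLoopProblemIn F S := by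
  obtain ⟨X, hX, σ, hσ⟩ := h
  exact ⟨X, hX, σ, hσ, hS X σ hσ⟩

theorem IsFinitelyGeneratedSemigroup.exists_monoid_generators {M : Type v} [Monoid M]
    (h : IsFinitelyGeneratedSemigroup.{u} M) :
    ∃ (X : Type u) (_ : Finite X) (σ : FreeMonoid X →* M), Function.Surjective σ := by
  obtain ⟨X, hX, σ, hσ⟩ := h
  refine ⟨X, hX, FreeMonoid.lift fun x => σ (FreeSemigroup.of x), fun m => ?_⟩
  obtain ⟨w, rfl⟩ := hσ m
  induction w using FreeSemigroup.recOnMul with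
  | ih1 x => exact ⟨FreeMonoid.of x, by simp⟩
  | ih2 x y _ ih =>
    obtain ⟨v, hv⟩ := ih
    exact ⟨FreeMonoid.of x * v, by simp [hv]⟩

/-! ### Maximal subgroups of completely simple semigroups -/

/-- The subgroup of all `s` with `e * s = s = s * e`, for an idempotent `e` with respect to which all
these elements have inverses. -/
def localSubgroup {S : Type v} [Semigroup S] (e : S) (he : e * e = e)
    (hinv : ∀ a : S, e * a = a → a * e = a →
      ∃ b, (e * b = b ∧ b * e = b) ∧ a * b = e ∧ b * a = e) : SemigroupSubgroup S where
  carrier := {s | e * s = s ∧ s * e = s}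
  mul_mem' {a b} ha hb := ⟨by rw [← mul_assoc, ha.1], by rw [mul_assoc, hb.2]⟩
  e := e
  e_mem := ⟨he, he⟩
  e_mul _ h := h.1
  mul_e _ h := h.2
  exists_inv a h := hinv a h.1 h.2

theorem SemigroupSubgroup.e_mul_e {S : Type v} [Semigroup S] (H : SemigroupSubgroup S) :
    H.e * H.e = H.e := H.e_mul _ H.e_mem

theorem SemigroupSubgroup.eq_e {S : Type v} [Semigroup S] (H : SemigroupSubgroup S) {f : S}
    (hf : f ∈ H.toSubsemigroup) (hff : f * f = f) : f = H.e := by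
  obtain ⟨y, -, hy, -⟩ := H.exists_inv f hf
  rw [← hy, ← hff, mul_assoc, hy, hff, H.mul_e f hf]

/-- A larger subgroup contains the idempotent `e`, which must be its identity; so `e` is a local
unit for all its elements. -/
theorem localSubgroup_isMaximal {S : Type v} [Semigroup S] (e : S) (he : e * e = e) (hinv) :
    (localSubgroup e he hinv).IsMaximal := by
  intro K hK
  have heK : e = K.e := K.eq_e (hK ⟨he, he⟩) he
  refine le_antisymm (fun s hs => ?_) hK
  subst heK
  exact ⟨K.e_mul s hs, K.mul_e s hs⟩

/-- The set `SaS` is an ideal, hence all of `S`. -/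
theorem IsCompletelySimple.exists_eq_mul {S : Type v} [Semigroup S] (hS : IsCompletelySimple S)
    (a s : S) : ∃ x y, x * a * y = s := by
  have := hS.2 {s | ∃ x y, x * a * y = s} ⟨⟨a * a * a, a, a, rfl⟩, ?_⟩
  · exact (Set.ext_iff.1 this s).2 trivial
  · rintro _ ⟨x, y, rfl⟩ s
    exact ⟨⟨s * x, y, by simp only [mul_assoc]⟩, ⟨x, y * s, by simp only [mul_assoc]⟩⟩

/-- A primitive idempotent of a simple semigroup is the identity of a group of local units. -/
theorem IsPrimitiveIdempotent.exists_inv {S : Type v} [Semigroup S] (hS : IsCompletelySimple S)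
    {e : S} (he : IsPrimitiveIdempotent e) (a : S) (hea : e * a = a) (hae : a * e = a) :
    ∃ b, (e * b = b ∧ b * e = b) ∧ a * b = e ∧ b * a = e := by
  have hee : e * e = e := he.1
  -- The non-zero clause of primitivity can be dropped: if `f` is a zero, then `e`, being of the
  -- form `x * f * y`, equals `f`.
  have hprim : ∀ f : S, f * f = f → e * f = f → f * e = f → f = e := by
    intro f hf h1 h2
    by_cases hz : IsZeroElement f
    · obtain ⟨x, y, hxy⟩ := hS.exists_eq_mul f e
      rw [(hz x).1, (hz y).2] at hxy
      exact hxy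
    · exact (he.2 f hf hz h1 h2).symm
  obtain ⟨x, y, hx1, hx2, hy1, hy2, hxy⟩ : ∃ x y, e * x = x ∧ x * e = x ∧ e * y = y ∧
      y * e = y ∧ x * a * y = e := by
    obtain ⟨x, y, hxy⟩ := hS.exists_eq_mul a e
    refine ⟨e * x * e, e * y * e, ?_, ?_, ?_, ?_, ?_⟩
    · simp only [← mul_assoc, hee]
    · rw [mul_assoc, hee]
    · simp only [← mul_assoc, hee]
    · rw [mul_assoc, hee]
    · calc e * x * e * a * (e * y * e) = e * (x * ((e * a) * e) * y) * e := by
            simp only [mul_assoc]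
        _ = e := by rw [hea, hae, hxy, hee, hee]
  -- From `x * a * y = e`, both `a * (y * x)` and `y * x * a` are idempotents below `e`, so
  -- primitivity makes them equal to `e`.
  refine ⟨y * x, ⟨by rw [← mul_assoc, hy1], by rw [mul_assoc, hx2]⟩, hprim _ ?_ ?_ ?_,
    hprim _ ?_ ?_ ?_⟩
  · calc a * (y * x) * (a * (y * x)) = a * (y * ((x * a * y) * x)) := by simp only [mul_assoc]
      _ = _ := by rw [hxy, hx1]
  · rw [← mul_assoc, hea]
  · rw [mul_assoc, mul_assoc, hx2]
  · calc y * x * a * (y * x * a) = y * ((x * a * y) * x) * a := by simp only [mul_assoc]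
      _ = _ := by rw [hxy, hx1]
  · rw [← mul_assoc, ← mul_assoc, hy1]
  · rw [mul_assoc, hae]

namespace SemigroupSubgroup

variable {S : Type v} [Semigroup S] (H : SemigroupSubgroup S)

theorem coe_one : ((1 : H.toSubsemigroup) : S) = H.e := rfl

theorem coe_mul (a b : H.toSubsemigroup) : ((a * b : H.toSubsemigroup) : S) = a * b := rfl

/-- `H` contains all elements for which its identity is a local unit. -/
def ContainsLocal : Prop := ∀ s, H.e * s = s → s * H.e = s → s ∈ H.toSubsemigroup

variable {H} (hH : H.ContainsLocal)

/-- The projection `s ↦ e * s * e` onto the subgroup. -/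
def localVal (hH : H.ContainsLocal) (s : S) : H.toSubsemigroup :=
  ⟨H.e * s * H.e, hH _ (by simp only [← mul_assoc, H.e_mul_e]) (by rw [mul_assoc, H.e_mul_e])⟩

/-- The inverse of `e * s * e` in the subgroup. -/
noncomputable def localInv (hH : H.ContainsLocal) (s : S) : S :=
  ((localVal hH s)⁻¹ : H.toSubsemigroup)

theorem e_mul_localInv (s : S) : H.e * localInv hH s = localInv hH s :=
  H.e_mul _ (Subtype.property _)

theorem localInv_mul_e (s : S) : localInv hH s * H.e = localInv hH s :=
  H.mul_e _ (Subtype.property _)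

theorem localInv_mul_mul_e (s : S) : localInv hH s * s * H.e = H.e := by
  have h : localInv hH s * (H.e * s * H.e) = H.e :=
    congrArg Subtype.val (inv_mul_cancel (localVal hH s))
  rwa [← mul_assoc, ← mul_assoc, localInv_mul_e] at h

theorem e_mul_mul_localInv (s : S) : H.e * s * localInv hH s = H.e := by
  have h : (H.e * s * H.e) * localInv hH s = H.e :=
    congrArg Subtype.val (mul_inv_cancel (localVal hH s))
  rwa [mul_assoc, e_mul_localInv] at h

/-- Simplicity gives `s = a * e * b`. Then `e * s * e` factors in the group as `(e * a * e) * (e * b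
* e)`, so inserting its inverse between `b` and `a` collapses the middle of the product to `e`. -/
theorem mul_localInv_mul (hS : IsCompletelySimple S) (s : S) : s * localInv hH s * s = s := by
  obtain ⟨a, b, rfl⟩ := hS.exists_eq_mul H.e s
  have hval : localVal hH (a * H.e * b) = localVal hH a * localVal hH b := by
    refine Subtype.ext ?_
    change H.e * (a * H.e * b) * H.e = H.e * a * H.e * (H.e * b * H.e)
    calc H.e * (a * H.e * b) * H.e = H.e * (a * (H.e * H.e) * b) * H.e := by rw [H.e_mul_e]
      _ = _ := by simp only [mul_assoc]
  have hmid : H.e * b * localInv hH (a * H.e * b) * a * H.e = H.e := by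
    have h : localVal hH b * (localVal hH (a * H.e * b))⁻¹ * localVal hH a = 1 := by
      rw [hval, mul_inv_rev, mul_inv_cancel_left, inv_mul_cancel]
    have h' : (H.e * b * H.e) * localInv hH (a * H.e * b) * (H.e * a * H.e) = H.e :=
      congrArg Subtype.val h
    rw [mul_assoc (H.e * b), e_mul_localInv] at h'
    simp only [← mul_assoc] at h'
    rwa [mul_assoc (H.e * b), localInv_mul_e] at h'
  calc a * H.e * b * localInv hH (a * H.e * b) * (a * H.e * b)
      = a * (H.e * b * localInv hH (a * H.e * b) * a * H.e) * b := by simp only [mul_assoc]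
    _ = _ := by rw [hmid]

theorem row_mul_aux (hS : IsCompletelySimple S) (s t : S) :
    s * t * localInv hH (s * t) = s * localInv hH s := by
  calc s * t * localInv hH (s * t)
      = (s * localInv hH s * s) * t * localInv hH (s * t) := by rw [mul_localInv_mul hH hS]
    _ = s * (localInv hH s * H.e) * s * t * localInv hH (s * t) := by rw [localInv_mul_e]
    _ = s * localInv hH s * (H.e * (s * t) * localInv hH (s * t)) := by simp only [mul_assoc]
    _ = _ := by rw [e_mul_mul_localInv, mul_assoc, localInv_mul_e]

theorem col_mul_aux (hS : IsCompletelySimple S) (s t : S) :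
    localInv hH (s * t) * (s * t) = localInv hH t * t := by
  calc localInv hH (s * t) * (s * t)
      = localInv hH (s * t) * (s * (t * localInv hH t * t)) := by rw [mul_localInv_mul hH hS]
    _ = localInv hH (s * t) * (s * (t * (H.e * localInv hH t) * t)) := by rw [e_mul_localInv]
    _ = (localInv hH (s * t) * (s * t) * H.e) * localInv hH t * t := by simp only [mul_assoc]
    _ = _ := by rw [localInv_mul_mul_e, e_mul_localInv]

theorem localVal_point {r q : S} (g : H.toSubsemigroup) (hr : H.e * r = H.e)
    (hq : q * H.e = H.e) : localVal hH (r * g * q) = g := by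
  refine Subtype.ext ?_
  change H.e * (r * g * q) * H.e = g
  calc H.e * (r * g * q) * H.e = (H.e * r) * g * (q * H.e) := by simp only [mul_assoc]
    _ = _ := by rw [hr, hq, H.e_mul _ g.2, H.mul_e _ g.2]

/-- The Rees coordinates of a completely simple semigroup with respect to a subgroup that contains
all elements with local unit its identity. -/
noncomputable def reesCoordinates (hH : H.ContainsLocal) (hS : IsCompletelySimple S) :
    ReesCoordinates S H.toSubsemigroup {r : S // r * H.e = r ∧ H.e * r = H.e}
      {q : S // H.e * q = q ∧ q * H.e = H.e} where
  -- With `s'` for `localInv hH s`, the coordinates come from the factorization `s = (s * s') * (e *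
  -- s * e) * (s' * s)`. The rows `r` and columns `q` are idempotents, and `q * r` lies in the
  -- subgroup.
  row s := ⟨s * localInv hH s, by rw [mul_assoc, localInv_mul_e],
    by rw [← mul_assoc, e_mul_mul_localInv]⟩
  val s := localVal hH s
  col s := ⟨localInv hH s * s, by rw [← mul_assoc, e_mul_localInv], localInv_mul_mul_e hH s⟩
  entry q r := ⟨q.1 * r.1, hH _ (by rw [← mul_assoc, q.2.1]) (by rw [mul_assoc, r.2.1])⟩
  point r g q := r * g * q
  row_point r g q := by
    refine Subtype.ext ?_
    change r.1 * g * q.1 * localInv hH (r.1 * g * q.1) = r.1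
    rw [← e_mul_localInv, mul_assoc (r.1 * g.1), ← mul_assoc q.1, q.2.2, e_mul_localInv,
      localInv, localVal_point hH g r.2.2 q.2.2, mul_assoc, ← coe_mul, mul_inv_cancel, coe_one,
      r.2.1]
  val_point r g q := localVal_point hH g r.2.2 q.2.2
  col_point r g q := by
    refine Subtype.ext ?_
    change localInv hH (r.1 * g * q.1) * (r.1 * g * q.1) = q.1
    rw [← localInv_mul_e, mul_assoc r.1, mul_assoc (localInv _ _), ← mul_assoc H.e, r.2.2,
      ← mul_assoc, localInv_mul_e, ← mul_assoc,
      localInv, ← mul_assoc r.1, localVal_point hH g r.2.2 q.2.2, ← coe_mul,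
      inv_mul_cancel, coe_one, q.2.1]
  point_eta s := by
    change s * localInv hH s * (H.e * s * H.e) * (localInv hH s * s) = s
    calc _ = s * (localInv hH s * H.e * s * H.e) * localInv hH s * s := by simp only [mul_assoc]
      _ = s := by
        rw [localInv_mul_e, localInv_mul_mul_e, mul_assoc s, e_mul_localInv,
          mul_localInv_mul hH hS]
  row_mul s t := Subtype.ext (row_mul_aux hH hS s t)
  col_mul s t := Subtype.ext (col_mul_aux hH hS s t)
  val_mul s t := by
    refine Subtype.ext ?_
    change H.e * (s * t) * H.e = H.e * s * H.e * (localInv hH s * s * (t * localInv hH t)) *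
      (H.e * t * H.e)
    calc H.e * (s * t) * H.e
        = H.e * ((s * localInv hH s * s) * (t * localInv hH t * t)) * H.e := by
          rw [mul_localInv_mul hH hS, mul_localInv_mul hH hS]
      _ = H.e * ((s * (H.e * localInv hH s) * s) * (t * (localInv hH t * H.e) * t)) * H.e := by
          rw [e_mul_localInv, localInv_mul_e]
      _ = _ := by simp only [mul_assoc]

end SemigroupSubgroup

theorem ReesCoordinates.val_of_idempotent {S : Type v} {G : Type w} {I Λ : Type*} [Semigroup S]
    [Group G] (R : ReesCoordinates S G I Λ) {f : S} (hf : f * f = f) :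
    R.val f = (R.entry (R.col f) (R.row f))⁻¹ := by
  have h := R.val_mul f f
  rw [hf, mul_assoc] at h
  exact eq_inv_of_mul_eq_one_right (mul_eq_left.1 h.symm)

/-- An idempotent below `f` has the row and column of `f`, and these determine the value of an
idempotent. -/
theorem ReesCoordinates.isPrimitiveIdempotent {S : Type v} {G : Type w} {I Λ : Type*} [Semigroup S]
    [Group G] (R : ReesCoordinates S G I Λ) {f : S} (hf : f * f = f) :
    IsPrimitiveIdempotent f := by
  refine ⟨hf, fun h hh _ h1 h2 => ?_⟩
  have hrow : R.row f = R.row h := by rw [← h1, R.row_mul]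
  have hcol : R.col f = R.col h := by rw [← h2, R.col_mul]
  refine R.ext hrow ?_ hcol
  rw [R.val_of_idempotent hf, R.val_of_idempotent hh, hrow, hcol]

theorem IsCompletelySimple.exists_isMaximal {S : Type v} [Semigroup S]
    (hS : IsCompletelySimple S) :
    ∃ H : SemigroupSubgroup S, H.IsMaximal ∧ H.ContainsLocal := by
  obtain ⟨e, he⟩ := hS.1
  exact ⟨localSubgroup e he.1 (he.exists_inv hS), localSubgroup_isMaximal _ _ _,
    fun s h1 h2 => ⟨h1, h2⟩⟩

/-- Coordinates over one known subgroup show that every idempotent is primitive, in particular the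
identity of `H`. The elements with this local unit then form a subgroup containing `H`, which
maximality identifies with `H`. -/
theorem SemigroupSubgroup.IsMaximal.containsLocal {S : Type v} [Semigroup S]
    (hS : IsCompletelySimple S) {H : SemigroupSubgroup S} (hH : H.IsMaximal) :
    H.ContainsLocal := by
  obtain ⟨K, -, hK⟩ := hS.exists_isMaximal
  have he := (SemigroupSubgroup.reesCoordinates hK hS).isPrimitiveIdempotent H.e_mul_e
  have h := hH (localSubgroup H.e H.e_mul_e (he.exists_inv hS))
    fun s hs => ⟨H.e_mul s hs, H.mul_e s hs⟩
  intro s h1 h2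
  rw [← h]
  exact ⟨h1, h2⟩

theorem mainTheorem3 (F : LanguageFamily.{u})
    (hFtransduction : F.ClosedUnderRationalTransduction)
    (hFkleene : F.ClosedUnderKleeneClosure)
    (S : Type v) [Semigroup S] (hS : IsCompletelySimple S)
    (hfg : IsFinitelyGeneratedSemigroup.{u} S) :
    (∀ H : SemigroupSubgroup S, H.IsMaximal →
      IsFinitelyGeneratedSemigroup.{u} H.toSubsemigroup) ∧
    List.TFAE [
      SomeSemigroupLoopProblemIn F S,
      EverySemigroupLoopProblemIn F S,
      ∀ H : SemigroupSubgroup S, H.IsMaximal → SomeSemigroupLoopProblemIn F H.toSubsemigroup,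
      ∀ H : SemigroupSubgroup S, H.IsMaximal → EverySemigroupLoopProblemIn F H.toSubsemigroup,
      ∀ H : SemigroupSubgroup S, H.IsMaximal → SomeMonoidLoopProblemIn F H.toSubsemigroup,
      ∀ H : SemigroupSubgroup S, H.IsMaximal → EveryMonoidLoopProblemIn F H.toSubsemigroup,
      ∀ H : SemigroupSubgroup S, H.IsMaximal → SomeWordProblemIn F H.toSubsemigroup,
      ∀ H : SemigroupSubgroup S, H.IsMaximal → EveryWordProblemIn F H.toSubsemigroup] := by
  have hne : Nonempty S := ⟨hS.1.choose⟩
  have hfgH : ∀ H : SemigroupSubgroup S, H.IsMaximal →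
      IsFinitelyGeneratedSemigroup.{u} H.toSubsemigroup := fun H hH =>
    (SemigroupSubgroup.reesCoordinates (hH.containsLocal hS) hS).isFinitelyGeneratedSemigroup hfg
  -- Finite generation supplies the choice of generators without which the "every" version would be
  -- vacuous.
  have hsome : ∀ H : SemigroupSubgroup S, H.IsMaximal → EveryWordProblemIn F H.toSubsemigroup →
      SomeWordProblemIn F H.toSubsemigroup := by
    intro H hH h
    obtain ⟨X, hX, σ, hσ⟩ := (hfgH H hH).exists_monoid_generators
    exact ⟨X, hX, σ, hσ, h X σ hσ⟩
  refine ⟨hfgH, ?_⟩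
  tfae_have 1 → 8 := fun h H _ => h.everyWordProblemIn hFtransduction
    (MulMemClass.subtype H.toSubsemigroup) Subtype.val_injective
  tfae_have 8 → 7 := fun h H hH => hsome H hH (h H hH)
  tfae_have 7 → 8 := fun h H hH => (h H hH).every hFtransduction
  -- A single maximal subgroup suffices here, since `S` has coordinates over it.
  tfae_have 7 → 2 := by
    intro h
    obtain ⟨H, hH, hloc⟩ := hS.exists_isMaximal
    exact (SemigroupSubgroup.reesCoordinates hloc hS).everySemigroupLoopProblemIn hFtransduction
      hFkleene (h H hH)
  tfae_have 2 → 1 := fun h => hfg.someSemigroupLoopProblemIn h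
  tfae_have 7 → 4 := fun h H hH => (ReesCoordinates.ofGroup _).everySemigroupLoopProblemIn
    hFtransduction hFkleene (h H hH)
  tfae_have 4 → 3 := fun h H hH => (hfgH H hH).someSemigroupLoopProblemIn (h H hH)
  tfae_have 3 → 8 := fun h H hH => (h H hH).everyWordProblemIn hFtransduction (MulHom.id _)
    Function.injective_id
  tfae_have 8 → 6 := fun h H hH => (h H hH).everyMonoidLoopProblemIn
  tfae_have 6 → 5 := by
    intro h H hH
    obtain ⟨X, hX, σ, hσ⟩ := (hfgH H hH).exists_monoid_generators
    exact ⟨X, hX, σ, hσ, h H hH X σ hσ⟩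
  tfae_have 5 → 7 := fun h H hH => (h H hH).someWordProblemIn
  tfae_finish
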